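/- Let $R$ be a commutative ring with unit and let $\mathbf{M}$ be either the category $\mathbf{Mod}_R$ of $R$-modules or the category $\mathbf{grMod}_R$ of $\mathbb{N}_0$-graded $R$-modules with degree-preserving $R$-linear maps (in the graded case $R$ may itself carry an $\mathbb{N}_0$-grading, the trivial grading being allowed). For a topological space $Z$ let $\Gamma(Z,-)\colon\mathbf{Shv}(Z,\mathbf{M})\to\mathbf{M}$ be the global section functor and $H^k(Z,-)=R^k\Gamma(Z,-)$ its $k$-th right derived functor. Let $f\colon X\to Y$ be a continuous map, $f_*\colon\mathbf{Shv}(X,\mathbf{M})\to\mathbf{Shv}(Y,\mathbf{M})$, $f_*\mathcal{G}(U)=\mathcal{G}(f^{-1}(U))$, the direct image functor, $f^*$ the inverse image functor ($f^*\mathcal{F}$ is the sheafification of $U\mapsto\operatorname{colim}_{f(U)\subseteq V}\mathcal{F}(V)$), and $\eta\colon\mathrm{id}\to f_*f^*$ the unit of the adjunction $f^*\dashv f_*$. For $\mathcal{F}\in\mathbf{Shv}(Y,\mathbf{M})$ the induced morphism $H^k(f)\colon H^k(Y,\mathcal{F})\to H^k(X,f^*\mathcal{F})$ is defined as follows: choose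 injective resolutions $0\to\mathcal{F}\to\mathcal{I}^\bullet$ and $0\to f^*\mathcal{F}\to\mathcal{J}^\bullet$ and a cochain morphism $g^\bullet\colon f^*\mathcal{I}^\bullet\to\mathcal{J}^\bullet$ lifting $\mathrm{id}_{f^*\mathcal{F}}$, let $\eta^\bullet=(\eta_{\mathcal{I}^n})_{n}\colon\mathcal{I}^\bullet\to f_*f^*\mathcal{I}^\bullet$, and put $$H^k(f)=H^k\big(\Gamma(X,g^\bullet)\big)\circ H^k\big(\Gamma(Y,\eta^\bullet)\big),$$ where $\Gamma(Y,f_*f^*\mathcal{I}^\bullet)=\Gamma(X,f^*\mathcal{I}^\bullet)$. Suppose that $f_*$ is exact. Then for every sheaf $\mathcal{G}\in\mathbf{Shv}(X,\mathbf{M})$ with an injective resolution $0\to\mathcal{G}\to\mathcal{J}^\bullet$ the sequence $0\to f_*\mathcal{G}\to f_*\mathcal{J}^\bullet$ is an injective resolution of $f_*\mathcal{G}$, and $\Gamma(Y,f_*\mathcal{J}^\bullet)=\Gamma(X,\mathcal{J}^\bullet)$; this gives an isomorphism $H^k(Y,f_*\mathcal{G})\cong H^k(X,\mathcal{G})$.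 Proposition. If $f_*$ is exact, then for every $\mathcal{F}\in\mathbf{Shv}(Y,\mathbf{M})$ and every $k\in\mathbb{N}_0$ the morphism $H^k(f)$, computed with any choice of $\mathcal{I}^\bullet$, $\mathcal{J}^\bullet$ and $g^\bullet$ as above, is equal to the composite $$H^k(Y,\mathcal{F})\xrightarrow{\;H^k(Y,\eta_{\mathcal{F}})\;}H^k(Y,f_*f^*\mathcal{F})\xrightarrow{\;\cong\;}H^k(X,f^*\mathcal{F}),$$ where the isomorphism is the one just described for $\mathcal{G}=f^*\mathcal{F}$, obtained from any injective resolution of $f^*\mathcal{F}$. -/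

import Mathlib

open CategoryTheory Limits Opposite TopologicalSpace

universe u

namespace SheafCohomology

section LeftKanExtension

variable {C D : Type u} [SmallCategory C] [SmallCategory D] {E : Type (u + 1)} [Category.{u} E]
  [Abelian E] [IsGrothendieckAbelian.{u} E]

/-- Left Kan extension along a flat functor is left exact if filtered colimits are exact. -/
lemma lan_preservesFiniteLimits (F : C ⥤ D) [RepresentablyFlat F] :
    PreservesFiniteLimits (F.op.lan : (Cᵒᵖ ⥤ E) ⥤ Dᵒᵖ ⥤ E) := by
  refine ⟨fun J _ _ => ?_⟩
  apply preservesLimitsOfShape_of_evaluation (F.op.lan : (Cᵒᵖ ⥤ E) ⥤ Dᵒᵖ ⥤ E) J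
  intro K
  have : IsFiltered (CostructuredArrow F.op K) :=
    IsFiltered.of_equivalence (structuredArrowOpEquivalence F (unop K))
  have : HasExactColimitsOfShape (CostructuredArrow F.op K) E := AB5OfSize.ofShape _
  exact preservesLimitsOfShape_of_natIso (lanEvaluationIsoColim _ _ _).symm

end LeftKanExtension

variable {A : Type (u + 1)} [Category.{u} A] [Abelian A] [IsGrothendieckAbelian.{u} A]
  [∀ Z : TopCat.{u}, HasSheafify (Opens.grothendieckTopology Z) A]

section Functors

variable {X Y : TopCat.{u}} (f : X ⟶ Y)

instance : (TopCat.Sheaf.pushforward A f).Additive where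
  map_add := rfl

variable (A) in
/-- The inverse image functor `f^*`: the sheafification of `U ↦ colim_{f(U) ⊆ V} F(V)`, the
colimit being expressed as a left Kan extension along `V ↦ f⁻¹(V)`. -/
noncomputable def inverseImage : Y.Sheaf A ⥤ X.Sheaf A :=
  TopCat.Sheaf.forget A Y ⋙ TopCat.Presheaf.pullback A f ⋙
    presheafToSheaf (Opens.grothendieckTopology X) A

variable (A) in
/-- The adjunction `f^* ⊣ f_*`. -/
noncomputable def adjunction : inverseImage A f ⊣ TopCat.Sheaf.pushforward A f :=
  Functor.sheafPullbackConstruction.sheafAdjunctionContinuous (Opens.map f) A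
    (Opens.grothendieckTopology Y) (Opens.grothendieckTopology X)

instance : (inverseImage A f).Additive :=
  (adjunction A f).left_adjoint_additive

instance : PreservesColimitsOfSize.{u, u} (inverseImage A f) :=
  (adjunction A f).leftAdjoint_preservesColimits

instance : PreservesFiniteColimits (inverseImage A f) := inferInstance

instance : PreservesFiniteLimits (inverseImage A f) := by
  have : PreservesFiniteLimits ((Opens.map f).op.lan : _ ⥤ _ ⥤ A) := lan_preservesFiniteLimits _
  exact inferInstanceAs (PreservesFiniteLimits (Functor.sheafPullbackConstruction.sheafPullback
    (Opens.map f) A (Opens.grothendieckTopology Y) (Opens.grothendieckTopology X)))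

variable (A) in
/-- The functor of global sections. -/
noncomputable def globalSections (X : TopCat.{u}) : X.Sheaf A ⥤ A :=
  TopCat.Sheaf.forget A X ⋙ (evaluation _ A).obj (op ⊤)

instance (X : TopCat.{u}) : (globalSections A X).Additive where
  map_add := rfl

/-- `Γ(Y, f_* G) = Γ(X, G)`. -/
noncomputable def pushforwardSections :
    TopCat.Sheaf.pushforward A f ⋙ globalSections A Y ≅ globalSections A X := Iso.refl _

end Functors

section Resolutions

variable {C D : Type*} [Category* C] [Category* D] [Abelian C] [Abelian D]

/-- The coaugmentation `F ⟶ I⁰` of an injective resolution. -/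
noncomputable def coaugmentation {F : C} (I : InjectiveResolution F) : F ⟶ I.cocomplex.X 0 :=
  I.ι.f 0

lemma exists_lift (G : C ⥤ D) [G.Additive] [PreservesFiniteLimits G] [PreservesFiniteColimits G]
    {F : C} (I : InjectiveResolution F) (J : InjectiveResolution (G.obj F)) :
    ∃ g : (G.mapHomologicalComplex _).obj I.cocomplex ⟶ J.cocomplex,
      G.map (coaugmentation I) ≫ g.f 0 = coaugmentation J := by
  have hm : Mono (coaugmentation I) := inferInstanceAs (Mono (I.ι.f 0))
  have hdI : coaugmentation I ≫ I.cocomplex.d 0 1 = 0 := I.ι_f_zero_comp_complex_d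
  have hdJ : coaugmentation J ≫ J.cocomplex.d 0 1 = 0 := J.ι_f_zero_comp_complex_d
  have h0 : ((ShortComplex.mk _ _ hdI).map G).Exact :=
    (show (ShortComplex.mk _ _ hdI).Exact from I.exact₀).map G
  have hs := fun n => (I.exact_succ n).map G
  let g0 : G.obj (I.cocomplex.X 0) ⟶ J.cocomplex.X 0 :=
    Injective.factorThru (coaugmentation J) (G.map (coaugmentation I))
  have hg0 : G.map (coaugmentation I) ≫ g0 = coaugmentation J := Injective.comp_factorThru _ _
  have w0 : G.map (coaugmentation I) ≫ g0 ≫ J.cocomplex.d 0 1 = 0 := by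
    rw [← Category.assoc, hg0, hdJ]
  let g1 : G.obj (I.cocomplex.X 1) ⟶ J.cocomplex.X 1 :=
    h0.descToInjective (g0 ≫ J.cocomplex.d 0 1) w0
  have hg1 : G.map (I.cocomplex.d 0 1) ≫ g1 = g0 ≫ J.cocomplex.d 0 1 :=
    h0.comp_descToInjective _ w0
  have hstep : ∀ (n : ℕ) (a : G.obj (I.cocomplex.X n) ⟶ J.cocomplex.X n)
      (b : G.obj (I.cocomplex.X (n + 1)) ⟶ J.cocomplex.X (n + 1)),
      a ≫ J.cocomplex.d n (n + 1) = G.map (I.cocomplex.d n (n + 1)) ≫ b →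
        G.map (I.cocomplex.d n (n + 1)) ≫ b ≫ J.cocomplex.d (n + 1) (n + 2) = 0 := by
    intro n a b h
    rw [← Category.assoc, ← h, Category.assoc, HomologicalComplex.d_comp_d, comp_zero]
  exact ⟨CochainComplex.mkHom _ _ g0 g1 hg1.symm fun n p =>
    ⟨(hs n).descToInjective (p.2.1 ≫ J.cocomplex.d (n + 1) (n + 2)) (by
      exact hstep n p.1 p.2.1 p.2.2),
      ((hs n).comp_descToInjective _ _).symm⟩, hg0⟩

/-- An exact functor which preserves injective objects preserves injective resolutions. -/
noncomputable def mapResolution (G : C ⥤ D) [G.Additive] [G.PreservesHomology]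
    (hG : ∀ I : C, Injective I → Injective (G.obj I))
    {F : C} (I : InjectiveResolution F) : InjectiveResolution (G.obj F) where
  cocomplex := (G.mapHomologicalComplex _).obj I.cocomplex
  injective n := hG _ (I.injective n)
  ι := (HomologicalComplex.singleMapHomologicalComplex G (ComplexShape.up ℕ) 0).inv.app F ≫
    (G.mapHomologicalComplex _).map I.ι
  quasiIso := by
    have : QuasiIso ((G.mapHomologicalComplex (ComplexShape.up ℕ)).map I.ι) := inferInstance
    infer_instance

end Resolutions

section Cohomology

variable {X Y : TopCat.{u}} (f : X ⟶ Y)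

variable (A) in
/-- Sheaf cohomology `H^k(X, -)`: the `k`-th right derived functor of global sections. -/
noncomputable def cohomology (X : TopCat.{u}) (k : ℕ) : X.Sheaf A ⥤ A :=
  (globalSections A X).rightDerived k

variable (A) in
/-- Exactness of `f_*`: short exact sequences of sheaves are mapped to short exact sequences. -/
def PushforwardExact : Prop :=
  ∀ S : ShortComplex (X.Sheaf A), S.ShortExact → (S.map (TopCat.Sheaf.pushforward A f)).ShortExact

variable {f} {F : Y.Sheaf A}

/-- A cochain map `g : f^* I ⟶ J` lifts the identity of `f^* F`, where `I` and `J` are injective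
resolutions of `F` and `f^* F`. -/
def LiftsIdentity (I : InjectiveResolution F) (J : InjectiveResolution ((inverseImage A f).obj F))
    (g : ((inverseImage A f).mapHomologicalComplex _).obj I.cocomplex ⟶ J.cocomplex) : Prop :=
  (inverseImage A f).map (coaugmentation I) ≫ g.f 0 = coaugmentation J

lemma exists_liftsIdentity (I : InjectiveResolution F)
    (J : InjectiveResolution ((inverseImage A f).obj F)) : ∃ g, LiftsIdentity I J g :=
  exists_lift (inverseImage A f) I J

variable (A f) in
/-- The maps `Γ(Y, F) ⟶ Γ(Y, f_* f^* F) = Γ(X, f^* F)` induced by the unit. -/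
noncomputable def unitSections : globalSections A Y ⟶ inverseImage A f ⋙ globalSections A X :=
  Functor.whiskerRight (adjunction A f).unit (globalSections A Y) ≫
    Functor.whiskerLeft (inverseImage A f) (pushforwardSections f).hom

/-- The cochain map `Γ(Y, η) : Γ(Y, I) ⟶ Γ(Y, f_* f^* I) = Γ(X, f^* I)` given by the unit in each
degree. -/
noncomputable def unitCochainMap (I : CochainComplex (Y.Sheaf A) ℕ) :
    ((globalSections A Y).mapHomologicalComplex _).obj I ⟶
      ((globalSections A X).mapHomologicalComplex _).obj
        (((inverseImage A f).mapHomologicalComplex _).obj I) :=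
  (NatTrans.mapHomologicalComplex (unitSections A f) _).app I

/-- The map `H^k(f) : H^k(Y, F) ⟶ H^k(X, f^* F)` computed with an injective resolution `I` of `F`,
an injective resolution `J` of `f^* F` and a cochain map `g : f^* I ⟶ J`: it is the composite of
`H^k(Γ(Y, η))` and `H^k(Γ(X, g))`. -/
noncomputable def inducedMap (I : InjectiveResolution F)
    (J : InjectiveResolution ((inverseImage A f).obj F))
    (g : ((inverseImage A f).mapHomologicalComplex _).obj I.cocomplex ⟶ J.cocomplex) (k : ℕ) :
    (cohomology A Y k).obj F ⟶ (cohomology A X k).obj ((inverseImage A f).obj F) :=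
  (I.isoRightDerivedObj (globalSections A Y) k).hom ≫
    HomologicalComplex.homologyMap (unitCochainMap I.cocomplex) k ≫
    HomologicalComplex.homologyMap (((globalSections A X).mapHomologicalComplex _).map g) k ≫
    (J.isoRightDerivedObj (globalSections A X) k).inv

lemma PushforwardExact.preservesHomology (hf : PushforwardExact A f) :
    (TopCat.Sheaf.pushforward A f).PreservesHomology :=
  ((TopCat.Sheaf.pushforward A f).exact_tfae.out 0 2).1 hf

/-- If `f_*` is exact and `J` is an injective resolution of `G`, then `f_* J` is an injective
resolution of `f_* G`. -/
noncomputable def pushforwardResolution (hf : PushforwardExact A f) {G : X.Sheaf A}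
    (J : InjectiveResolution G) :
    InjectiveResolution ((TopCat.Sheaf.pushforward A f).obj G) :=
  have := hf.preservesHomology
  mapResolution _ (fun I hI => (adjunction A f).map_injective I hI) J

/-- The isomorphism `H^k(Y, f_* G) ≅ H^k(X, G)` for exact `f_*`: if `J` is an injective resolution
of `G`, both sides are the `k`-th cohomology of `Γ(Y, f_* J) = Γ(X, J)`. -/
noncomputable def pushforwardCohomologyIso (hf : PushforwardExact A f) {G : X.Sheaf A}
    (J : InjectiveResolution G) (k : ℕ) :
    (cohomology A Y k).obj ((TopCat.Sheaf.pushforward A f).obj G) ≅ (cohomology A X k).obj G :=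
  (pushforwardResolution hf J).isoRightDerivedObj (globalSections A Y) k ≪≫
    (HomologicalComplex.homologyFunctor A _ k).mapIso
      ((NatIso.mapHomologicalComplex (pushforwardSections f) _).app J.cocomplex) ≪≫
    (J.isoRightDerivedObj (globalSections A X) k).symm

end Cohomology
end SheafCohomology

namespace AdditiveDiagrams
variable (C : Type) [Category.{u} C] [Preadditive C]

/-- The additive functors from a small preadditive category to abelian groups. -/
abbrev isAdditive : ObjectProperty (C ⥤ AddCommGrpCat.{u}) := fun F => F.Additive

instance closedLim (J : Type*) [Category* J] [HasLimitsOfShape J AddCommGrpCat.{u}] :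
    (isAdditive C).IsClosedUnderLimitsOfShape J where
  limitsOfShape_le := by
    rintro F ⟨⟨⟨D, π, hc⟩, hD⟩⟩
    refine ⟨fun {X Y f g} => ?_⟩
    have hY := isLimitOfPreserves ((evaluation C AddCommGrpCat.{u}).obj Y) hc
    refine hY.hom_ext fun j => ?_
    have : (D.obj j).Additive := hD j
    have h : ∀ k : X ⟶ Y, F.map k ≫ (π.app j).app Y = (π.app j).app X ≫ (D.obj j).map k :=
      fun k => (π.app j).naturality k
    change F.map (f + g) ≫ (π.app j).app Y = (F.map f + F.map g) ≫ (π.app j).app Y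
    rw [Preadditive.add_comp, h, h, h, Functor.map_add, Preadditive.comp_add]

instance closedColim (J : Type*) [Category* J] [HasColimitsOfShape J AddCommGrpCat.{u}] :
    (isAdditive C).IsClosedUnderColimitsOfShape J where
  colimitsOfShape_le := by
    rintro F ⟨⟨⟨D, ι, hc⟩, hD⟩⟩
    refine ⟨fun {X Y f g} => ?_⟩
    have hX := isColimitOfPreserves ((evaluation C AddCommGrpCat.{u}).obj X) hc
    refine hX.hom_ext fun j => ?_
    have : (D.obj j).Additive := hD j
    have h : ∀ k : X ⟶ Y, (ι.app j).app X ≫ F.map k = (D.obj j).map k ≫ (ι.app j).app Y :=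
      fun k => ((ι.app j).naturality k).symm
    change (ι.app j).app X ≫ F.map (f + g) = (ι.app j).app X ≫ (F.map f + F.map g)
    rw [Preadditive.comp_add, h, h, h, Functor.map_add, Preadditive.add_comp]

instance : (isAdditive C).ContainsZero where
  exists_zero := ⟨(Functor.const C).obj (AddCommGrpCat.of PUnit.{u + 1}),
    (Functor.isZero _ fun _ =>
      AddCommGrpCat.isZero_of_subsingleton (AddCommGrpCat.of PUnit.{u + 1})),
    ⟨(AddCommGrpCat.isZero_of_subsingleton (AddCommGrpCat.of PUnit.{u + 1})).eq_of_src _ _⟩⟩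

instance : (isAdditive C).IsClosedUnderKernels where
  kernels_le := by
    rintro _ ⟨f, k, hk, hf⟩
    exact (isAdditive C).prop_of_isLimit hk (by rintro (_ | _); exacts [hf.1, hf.2])

instance : (isAdditive C).IsClosedUnderCokernels where
  cokernels_le := by
    rintro _ ⟨f, k, hk, hf⟩
    exact (isAdditive C).prop_of_isColimit hk (by rintro (_ | _); exacts [hf.1, hf.2])

instance : (isAdditive C).IsClosedUnderFiniteProducts where

instance : HasColimitsOfSize.{u,u} (isAdditive C).FullSubcategory where
instance : HasLimitsOfSize.{u,u} (isAdditive C).FullSubcategory where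

instance : PreservesLimitsOfSize.{u,u} (isAdditive C).ι where
instance : PreservesColimitsOfSize.{u,u} (isAdditive C).ι where

instance : AB5OfSize.{u,u} (isAdditive C).FullSubcategory where
  ofShape J _ _ := by
    have : HasExactColimitsOfShape J AddCommGrpCat.{u} := inferInstance
    have : PreservesFiniteLimits (isAdditive C).ι := inferInstance
    have : ReflectsFiniteLimits (isAdditive C).ι := inferInstance
    exact HasExactColimitsOfShape.domain_of_functor J (isAdditive C).ι

/-- The additive functor represented by `X`. -/
def corepresentable (X : C) : (isAdditive C).FullSubcategory :=
  ⟨preadditiveCoyoneda.obj (op X), inferInstance⟩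

/-- The Yoneda map attached to an element of the value of an additive functor. -/
def yonedaMap {X : C} (F : (isAdditive C).FullSubcategory) (x : F.obj.obj X) :
    corepresentable C X ⟶ F :=
  have : F.obj.Additive := F.property
  ObjectProperty.homMk
    { app := fun Y => AddCommGrpCat.ofHom (Y := F.obj.obj Y)
        (AddMonoidHom.mk' (fun g : X ⟶ Y => (F.obj.map g).hom x) fun g h =>
          congrArg (fun k => AddCommGrpCat.Hom.hom k x) (F.obj.map_add (f := g) (g := h)))
      naturality := fun Y Z g => by
        ext k
        exact congrArg (fun l => AddCommGrpCat.Hom.hom l x) (F.obj.map_comp (X := X) k g) }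

lemma yonedaMap_id {X : C} (F : (isAdditive C).FullSubcategory) (x : F.obj.obj X) :
    ((yonedaMap C F x).hom.app X).hom (𝟙 X) = x := by
  exact congrArg (fun l => AddCommGrpCat.Hom.hom l x) (F.obj.map_id X)

instance : HasSeparator (isAdditive C).FullSubcategory := by
  refine ⟨∐ fun X : ULift.{u} C => corepresentable C X.down, ?_⟩
  rw [isSeparator_sigma]
  intro F G f g hfg
  ext X x
  have h := hfg _ (ObjectProperty.ofObj_apply _ (ULift.up X)) (yonedaMap C F x)
  have h' := congrArg (fun k => (k.hom.app X).hom (𝟙 X)) h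
  change (f.hom.app X).hom (((yonedaMap C F x).hom.app X).hom (𝟙 X)) =
    (g.hom.app X).hom (((yonedaMap C F x).hom.app X).hom (𝟙 X)) at h'
  rwa [yonedaMap_id] at h'

noncomputable instance : IsGrothendieckAbelian.{u} (isAdditive C).FullSubcategory where


section Sheafification

variable {C}
variable {A : Type (u + 1)} [Category.{u} A] (E : A ⥤ (isAdditive C).FullSubcategory)
  [E.IsEquivalence] {O : Type u} [Category.{u} O] (J : GrothendieckTopology O)

/-- Evaluation at an object `c`. -/
abbrev component (c : C) : A ⥤ AddCommGrpCat.{u} :=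
  E ⋙ (isAdditive C).ι ⋙ (evaluation C AddCommGrpCat.{u}).obj c

instance (c : C) : PreservesLimitsOfSize.{u, u} (component E c) where

lemma isSheaf_of_components (P : Oᵒᵖ ⥤ A)
    (h : ∀ c, Presheaf.IsSheaf J (P ⋙ component E c)) : Presheaf.IsSheaf J P := by
  rw [Presheaf.isSheaf_iff_isLimit]
  intro X S hS
  refine ⟨isLimitOfReflects (E ⋙ (isAdditive C).ι) (evaluationJointlyReflectsLimits _ fun c => ?_)⟩
  exact ((Presheaf.isSheaf_iff_isLimit J _).1 (h c) S hS).some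

/-- Presheaves with values in `A` as `C`-indexed diagrams of presheaves of abelian groups. -/
abbrev toPresheafDiagram : (Oᵒᵖ ⥤ A) ⥤ (C ⥤ Oᵒᵖ ⥤ AddCommGrpCat.{u}) :=
  (Functor.whiskeringRight Oᵒᵖ _ _).obj (E ⋙ (isAdditive C).ι) ⋙
    (Functor.flipping : (Oᵒᵖ ⥤ C ⥤ AddCommGrpCat.{u}) ≌ _).functor

/-- Sheaves with values in `A` as `C`-indexed diagrams of sheaves of abelian groups. -/
def toSheafDiagram : Sheaf J A ⥤ (C ⥤ Sheaf J AddCommGrpCat.{u}) where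
  obj G :=
    { obj := fun c => ⟨G.obj ⋙ component E c, Presheaf.isSheaf_comp_of_isSheaf J _ _ G.property⟩
      map := fun a => ⟨((toPresheafDiagram E).obj G.obj).map a⟩
      map_id := fun c => by ext1; exact ((toPresheafDiagram E).obj G.obj).map_id c
      map_comp := fun a b => by ext1; exact ((toPresheafDiagram E).obj G.obj).map_comp a b }
  map φ :=
    { app := fun c => ⟨((toPresheafDiagram E).map φ.hom).app c⟩
      naturality := fun c d a => by
        ext1; exact ((toPresheafDiagram E).map φ.hom).naturality a }

instance : (toPresheafDiagram (O := O) E).Full := inferInstance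
instance : (toPresheafDiagram (O := O) E).Faithful := inferInstance

/-- The two functors are compatible with forgetting the sheaf condition. -/
def toSheafDiagramComp : toSheafDiagram E J ⋙
      (Functor.whiskeringRight C _ _).obj (sheafToPresheaf J AddCommGrpCat.{u}) ≅
    sheafToPresheaf J A ⋙ toPresheafDiagram E := Iso.refl _

instance : (toSheafDiagram E J).Faithful :=
  have : (toSheafDiagram E J ⋙
      (Functor.whiskeringRight C _ _).obj (sheafToPresheaf J AddCommGrpCat.{u})).Faithful :=
    Functor.Faithful.of_iso (toSheafDiagramComp E J).symm
  Functor.Faithful.of_comp _ ((Functor.whiskeringRight C _ _).obj (sheafToPresheaf J _))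

instance : (toSheafDiagram E J).Full :=
  have : (toSheafDiagram E J ⋙
      (Functor.whiskeringRight C _ _).obj (sheafToPresheaf J AddCommGrpCat.{u})).Full :=
    Functor.Full.of_iso (toSheafDiagramComp E J).symm
  Functor.Full.of_comp_faithful _ ((Functor.whiskeringRight C _ _).obj (sheafToPresheaf J _))

lemma mem_essImage (S : C ⥤ Sheaf J AddCommGrpCat.{u}) (hS : S.Additive) :
    (toSheafDiagram E J).essImage S := by
  let Q : Oᵒᵖ ⥤ (isAdditive C).FullSubcategory :=
    (isAdditive C).lift (S ⋙ sheafToPresheaf J _).flip fun U =>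
      ⟨fun {X Y f g} => by
        have h := S.map_add (f := f) (g := g)
        exact congrArg (fun k => k.hom.app U) h⟩
  let e : (Q ⋙ E.inv) ⋙ E ≅ Q := Functor.associator _ _ _ ≪≫
    Functor.isoWhiskerLeft Q E.asEquivalence.counitIso ≪≫ Q.rightUnitor
  let e' : ∀ c, (Q ⋙ E.inv) ⋙ component E c ≅ (S.obj c).obj := fun c =>
    Functor.isoWhiskerRight e ((isAdditive C).ι ⋙ (evaluation C AddCommGrpCat.{u}).obj c)
  refine ⟨⟨Q ⋙ E.inv, isSheaf_of_components E J _ fun c =>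
    (Presheaf.isSheaf_of_iso_iff (e' c)).2 (S.obj c).property⟩, ⟨?_⟩⟩
  refine NatIso.ofComponents (fun c => (fullyFaithfulSheafToPresheaf J _).preimageIso (e' c)) ?_
  intro c d a
  ext U : 3
  exact (e.hom.app U).hom.naturality a

theorem hasSheafify {C : Type} [Category.{u} C] [Preadditive C]
    {A : Type (u + 1)} [Category.{u} A] (E : A ⥤ (isAdditive C).FullSubcategory)
    [E.IsEquivalence] {O : Type u} [Category.{u} O] (J : GrothendieckTopology O)
    [HasSheafify J AddCommGrpCat.{u}] : HasSheafify J A := by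
  let S := presheafToSheaf J AddCommGrpCat.{u}
  let W := (Functor.whiskeringRight C _ _).obj S
  have hL : ∀ P : Oᵒᵖ ⥤ A, (toSheafDiagram E J).essImage ((toPresheafDiagram E ⋙ W).obj P) :=
    fun P => mem_essImage E J _ (by
      have : Functor.Additive ((toPresheafDiagram E).obj P) :=
        ⟨fun {X Y f g} => by
          ext1
          ext1 U
          have : (E.obj (P.obj U)).obj.Additive := (E.obj (P.obj U)).property
          exact (E.obj (P.obj U)).obj.map_add⟩
      change Functor.Additive ((toPresheafDiagram E).obj P ⋙ S)
      infer_instance)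
  let L := Functor.essImage.liftFunctor (toPresheafDiagram E ⋙ W) (toSheafDiagram E J) hL
  let i : L ⋙ toSheafDiagram E J ≅ toPresheafDiagram E ⋙ W :=
    Functor.essImage.liftFunctorCompIso _ _ hL
  have adj : L ⊣ sheafToPresheaf J A :=
    ((sheafificationAdjunction J AddCommGrpCat.{u}).whiskerRight C).restrictFullyFaithful
      (Functor.FullyFaithful.ofFullyFaithful (toPresheafDiagram E))
      (Functor.FullyFaithful.ofFullyFaithful (toSheafDiagram E J)) i.symm
      (toSheafDiagramComp E J)
  have : PreservesFiniteLimits (toPresheafDiagram (O := O) E) := by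
    have : PreservesFiniteLimits (E ⋙ (isAdditive C).ι) := inferInstance
    have : PreservesFiniteLimits ((Functor.whiskeringRight Oᵒᵖ _ _).obj
      (E ⋙ (isAdditive C).ι)) := ⟨fun K _ _ => by
        have : HasLimitsOfShape K A := Adjunction.hasLimitsOfShape_of_equivalence E
        infer_instance⟩
    exact comp_preservesFiniteLimits _ _
  have : PreservesFiniteLimits W := ⟨fun K _ _ => inferInstance⟩
  have : PreservesFiniteLimits (L ⋙ toSheafDiagram E J) :=
    preservesFiniteLimits_of_natIso i.symm
  have : PreservesFiniteLimits L :=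
    preservesFiniteLimits_of_reflects_of_preserves L (toSheafDiagram E J)
  exact HasSheafify.mk' J A adj

end Sheafification
end AdditiveDiagrams

/-- An `ℕ`-graded module over the graded ring `R = ⨁ 𝒜 n`: an `R`-module which is the internal
direct sum of additive subgroups `piece n` with `𝒜 m • piece n ⊆ piece (m + n)`. -/
structure GrModCat {R : Type u} [CommRing R] (𝒜 : ℕ → AddSubgroup R) [GradedRing 𝒜] where
  carrier : Type u
  [addCommGroup : AddCommGroup carrier]
  [module : Module R carrier]
  piece : ℕ → AddSubgroup carrier
  [decomposition : DirectSum.Decomposition piece]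
  [gradedSMul : SetLike.GradedSMul 𝒜 piece]

namespace GrModCat

attribute [instance] addCommGroup module decomposition gradedSMul

variable {R : Type u} [CommRing R] {𝒜 : ℕ → AddSubgroup R} [GradedRing 𝒜]

/-- Morphisms of graded modules: the `R`-linear maps which preserve degrees. -/
@[ext]
structure Hom (M N : GrModCat 𝒜) where
  toLinearMap : M.carrier →ₗ[R] N.carrier
  map_mem : ∀ (n : ℕ) (x : M.carrier), x ∈ M.piece n → toLinearMap x ∈ N.piece n

instance : Category (GrModCat 𝒜) where
  Hom := Hom
  id M := ⟨LinearMap.id, fun _ _ h => h⟩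
  comp f g := ⟨g.toLinearMap ∘ₗ f.toLinearMap, fun n x h => g.map_mem n _ (f.map_mem n x h)⟩

@[ext]
lemma hom_ext {M N : GrModCat 𝒜} {f g : M ⟶ N} (h : f.toLinearMap = g.toLinearMap) : f = g :=
  Hom.ext h

section Instances

variable {M N : GrModCat 𝒜}

instance : Zero (M ⟶ N) := ⟨⟨0, fun n _ _ => (N.piece n).zero_mem⟩⟩
instance : Add (M ⟶ N) := ⟨fun f g => ⟨f.toLinearMap + g.toLinearMap, fun n x h =>
  (N.piece n).add_mem (f.map_mem n x h) (g.map_mem n x h)⟩⟩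
instance : Neg (M ⟶ N) := ⟨fun f => ⟨-f.toLinearMap, fun n x h =>
  (N.piece n).neg_mem (f.map_mem n x h)⟩⟩
instance : Sub (M ⟶ N) := ⟨fun f g => ⟨f.toLinearMap - g.toLinearMap, fun n x h =>
  (N.piece n).sub_mem (f.map_mem n x h) (g.map_mem n x h)⟩⟩
instance : SMul ℕ (M ⟶ N) := ⟨fun k f => ⟨k • f.toLinearMap, fun n x h =>
  (N.piece n).nsmul_mem (f.map_mem n x h) k⟩⟩
instance : SMul ℤ (M ⟶ N) := ⟨fun k f => ⟨k • f.toLinearMap, fun n x h =>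
  (N.piece n).zsmul_mem (f.map_mem n x h) k⟩⟩

instance : AddCommGroup (M ⟶ N) :=
  Function.Injective.addCommGroup (fun f : M ⟶ N => f.toLinearMap) (fun _ _ h => Hom.ext h)
    rfl (fun _ _ => rfl) (fun _ => rfl) (fun _ _ => rfl) (fun _ _ => rfl) (fun _ _ => rfl)

end Instances

instance : Preadditive (GrModCat 𝒜) where
  add_comp _ _ _ f f' g := by
    ext x
    exact map_add g.toLinearMap (f.toLinearMap x) (f'.toLinearMap x)
  comp_add _ _ _ _ _ _ := rfl

end GrModCat

/-- The preadditive category with one object for each degree whose morphisms `i ⟶ j` are the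
homogeneous elements of degree `j - i`. -/
structure GradedIndex {R : Type u} [CommRing R] (𝒜 : ℕ → AddSubgroup R) where
  deg : ℕ

namespace GradedIndex

variable {R : Type u} [CommRing R] (𝒜 : ℕ → AddSubgroup R)

/-- The homogeneous elements of degree `j - i`; only zero if `j < i`. -/
def homs (i j : ℕ) : AddSubgroup R where
  carrier := {a | a = 0 ∨ ∃ k, k + i = j ∧ a ∈ 𝒜 k}
  zero_mem' := Or.inl rfl
  add_mem' := by
    rintro a b (rfl | ⟨k, hk, ha⟩) (rfl | ⟨l, hl, hb⟩)
    · simp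
    · exact Or.inr ⟨l, hl, by simpa using hb⟩
    · exact Or.inr ⟨k, hk, by simpa using ha⟩
    · obtain rfl : k = l := by omega
      exact Or.inr ⟨k, hk, (𝒜 k).add_mem ha hb⟩
  neg_mem' := by
    rintro a (rfl | ⟨k, hk, ha⟩)
    · simp
    · exact Or.inr ⟨k, hk, (𝒜 k).neg_mem ha⟩

variable [GradedRing 𝒜]

instance : Category.{u} (GradedIndex 𝒜) where
  Hom i j := homs 𝒜 i.deg j.deg
  id i := ⟨1, Or.inr ⟨0, by simp, SetLike.GradedOne.one_mem⟩⟩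
  comp {i j k} a b := ⟨b.1 * a.1, by
    obtain ⟨a, ha⟩ := a
    obtain ⟨b, hb⟩ := b
    rcases ha with rfl | ⟨m, hm, ha⟩
    · exact Or.inl (by simp)
    · rcases hb with rfl | ⟨n, hn, hb⟩
      · exact Or.inl (by simp)
      · exact Or.inr ⟨n + m, by omega, SetLike.mul_mem_graded hb ha⟩⟩
  id_comp a := Subtype.ext (mul_one a.1)
  comp_id a := Subtype.ext (one_mul a.1)
  assoc a b c := Subtype.ext (mul_assoc c.1 b.1 a.1).symm

instance : Preadditive (GradedIndex 𝒜) where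
  homGroup i j := inferInstanceAs (AddCommGroup (homs 𝒜 i.deg j.deg))
  add_comp _ _ _ a b c := Subtype.ext (mul_add c.1 a.1 b.1)
  comp_add _ _ _ a b c := Subtype.ext (add_mul b.1 c.1 a.1)

end GradedIndex

namespace GrModCat

open AdditiveDiagrams DirectSum

variable {R : Type u} [CommRing R] {𝒜 : ℕ → AddSubgroup R} [GradedRing 𝒜]

lemma smul_mem_piece (M : GrModCat 𝒜) {i j : ℕ} {a : R} (ha : a ∈ GradedIndex.homs 𝒜 i j)
    {x : M.carrier} (hx : x ∈ M.piece i) : a • x ∈ M.piece j := by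
  rcases ha with rfl | ⟨k, rfl, ha⟩
  · simp
  · exact SetLike.GradedSMul.smul_mem ha hx

/-- Multiplication by a homogeneous element. -/
def smulHom (M : GrModCat 𝒜) {i j : ℕ} (a : GradedIndex.homs 𝒜 i j) : M.piece i →+ M.piece j :=
  AddMonoidHom.mk' (fun x => ⟨a.1 • x.1, M.smul_mem_piece a.2 x.2⟩)
    fun x y => Subtype.ext (smul_add a.1 x.1 y.1)

variable (𝒜) in
/-- A graded module as the additive diagram of its homogeneous pieces. -/
def toDiagram : GrModCat 𝒜 ⥤ (isAdditive (GradedIndex 𝒜)).FullSubcategory where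
  obj M := ⟨{ obj := fun i => AddCommGrpCat.of (M.piece i.deg)
              map := fun a => AddCommGrpCat.ofHom (M.smulHom a)
              map_id := fun i => by
                ext x
                exact one_smul R x.1
              map_comp := fun a b => by
                ext x
                exact mul_smul b.1 a.1 x.1 }, ⟨fun {i j a b} => by
                  ext x
                  exact add_smul a.1 b.1 x.1⟩⟩
  map {M N} f := ObjectProperty.homMk
    { app := fun i => AddCommGrpCat.ofHom (AddMonoidHom.mk'
        (fun x : M.piece i.deg => (⟨f.toLinearMap x.1, f.map_mem _ _ x.2⟩ : N.piece i.deg))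
        fun x y => Subtype.ext (map_add f.toLinearMap x.1 y.1))
      naturality := fun i j a => by
        ext x
        exact map_smul f.toLinearMap a.1 x.1 }

instance : (toDiagram 𝒜).Faithful where
  map_injective {M N f g} h := by
    ext x
    induction x using DirectSum.Decomposition.inductionOn M.piece with
    | zero => simp
    | @homogeneous i x =>
      have h' := congrArg (fun k => ((k.hom.app ⟨i⟩).hom x)) h
      exact congrArg Subtype.val h'
    | add x y hx hy => simp [hx, hy]

instance : (toDiagram 𝒜).Full where
  map_surjective {M N} φ := by
    let φ' : ∀ i, M.piece i →+ N.piece i := fun i => (φ.hom.app ⟨i⟩).hom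
    have hφ : ∀ {i j : ℕ} (a : GradedIndex.homs 𝒜 i j) (x : M.piece i),
        (φ' j (M.smulHom a x)).1 = a.1 • (φ' i x).1 := fun {i j} a x =>
      congrArg Subtype.val (congrArg (fun k => AddCommGrpCat.Hom.hom k x)
        (φ.hom.naturality (X := ⟨i⟩) (Y := ⟨j⟩) a))
    let g : M.carrier →+ N.carrier :=
      (DirectSum.toAddMonoid fun i => (N.piece i).subtype.comp (φ' i)).comp
        (DirectSum.decomposeAddEquiv M.piece).toAddMonoidHom
    have hg : ∀ {i} (x : M.piece i), g x.1 = (φ' i x).1 := fun {i} x => by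
      simp [g]
    have hlin : ∀ (r : R) (x : M.carrier), g (r • x) = r • g x := by
      intro r x
      induction r using DirectSum.Decomposition.inductionOn 𝒜 with
      | zero => simp
      | add r s hr hs => simp [add_smul, hr, hs]
      | @homogeneous k a =>
        induction x using DirectSum.Decomposition.inductionOn M.piece with
        | zero => simp
        | add x y hx hy => simp [smul_add, hx, hy]
        | @homogeneous i x =>
          have h := hφ (j := k + i) ⟨a.1, Or.inr ⟨k, rfl, a.2⟩⟩ x
          rw [← hg, ← hg] at h
          exact h
    refine ⟨⟨{ g with map_smul' := hlin }, fun n x hx => ?_⟩, ?_⟩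
    · change g x ∈ N.piece n
      rw [hg ⟨x, hx⟩]
      exact (φ' n ⟨x, hx⟩).2
    · ext i x
      exact Subtype.ext (hg x)

end GrModCat

namespace GrModCat

open AdditiveDiagrams DirectSum

variable {R : Type u} [CommRing R] {𝒜 : ℕ → AddSubgroup R} [GradedRing 𝒜]

section EssSurj

variable (F : (isAdditive (GradedIndex 𝒜)).FullSubcategory)

/-- The value of a diagram in degree `i`. -/
abbrev value (i : ℕ) : Type u := F.obj.obj ⟨i⟩

/-- The action of a homogeneous element of degree `j - i`. -/
def act {i j : ℕ} (a : GradedIndex.homs 𝒜 i j) : value F i →+ value F j :=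
  (F.obj.map (X := ⟨i⟩) (Y := ⟨j⟩) a).hom

lemma act_congr {i j j' : ℕ} (a : GradedIndex.homs 𝒜 i j) (b : GradedIndex.homs 𝒜 i j')
    (hj : j = j') (hab : a.1 = b.1) (x : value F i) :
    (⟨j, act F a x⟩ : GradedMonoid (value F)) = ⟨j', act F b x⟩ := by
  subst hj
  obtain rfl : a = b := Subtype.ext hab
  rfl

lemma act_add {i j : ℕ} (a b : GradedIndex.homs 𝒜 i j) (x : value F i) :
    act F (a + b) x = act F a x + act F b x := by
  have : F.obj.Additive := F.property
  exact congrArg (fun k => AddCommGrpCat.Hom.hom k x)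
    (F.obj.map_add (X := ⟨i⟩) (Y := ⟨j⟩) (f := a) (g := b))

lemma act_zero {i j : ℕ} (x : value F i) : act F (0 : GradedIndex.homs 𝒜 i j) x = 0 := by
  simpa using act_add F (0 : GradedIndex.homs 𝒜 i j) 0 x

instance gmodule : Gmodule (fun i => 𝒜 i) (value F) where
  smul {i j} a x := act F (j := i + j) ⟨a.1, Or.inr ⟨i, rfl, a.2⟩⟩ x
  one_smul := by
    rintro ⟨i, x⟩
    have h : act F (j := i) ⟨1, Or.inr ⟨0, by simp, SetLike.GradedOne.one_mem⟩⟩ x = x :=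
      congrArg (fun k => AddCommGrpCat.Hom.hom k x) (F.obj.map_id ⟨i⟩)
    refine Eq.trans ?_ (congrArg (fun y => (⟨i, y⟩ : GradedMonoid (value F))) h)
    exact act_congr F _ _ (zero_add i) rfl x
  mul_smul := by
    rintro ⟨k, a⟩ ⟨l, b⟩ ⟨i, x⟩
    have h : act F (j := k + (l + i)) ⟨a.1 * b.1, Or.inr ⟨k + l, by omega,
        SetLike.mul_mem_graded a.2 b.2⟩⟩ x =
        act F (j := k + (l + i)) ⟨a.1, Or.inr ⟨k, rfl, a.2⟩⟩
          (act F (j := l + i) ⟨b.1, Or.inr ⟨l, rfl, b.2⟩⟩ x) :=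
      congrArg (fun k => AddCommGrpCat.Hom.hom k x)
        (F.obj.map_comp (X := ⟨i⟩) (Y := ⟨l + i⟩) (Z := ⟨k + (l + i)⟩)
          (⟨b.1, Or.inr ⟨l, rfl, b.2⟩⟩ : GradedIndex.homs 𝒜 _ _)
          (⟨a.1, Or.inr ⟨k, rfl, a.2⟩⟩ : GradedIndex.homs 𝒜 _ _))
    refine Eq.trans ?_ (congrArg (fun y => (⟨_, y⟩ : GradedMonoid (value F))) h)
    exact act_congr F _ _ (add_assoc k l i) rfl x
  smul_add a x y := map_add _ x y
  smul_zero a := map_zero _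
  add_smul {i j} a b x := act_add F (j := i + j) ⟨a.1, Or.inr ⟨i, rfl, a.2⟩⟩
    ⟨b.1, Or.inr ⟨i, rfl, b.2⟩⟩ x
  zero_smul {i j} x := act_zero F x

/-- The direct sum of the values of a diagram. -/
abbrev Total : Type u := ⨁ i, value F i

noncomputable instance totalGradedModule : Module (⨁ i, 𝒜 i) (Total F) :=
  DirectSum.Gmodule.module (fun i => 𝒜 i) (value F)

noncomputable instance totalModule : Module R (Total F) :=
  Module.compHom _ (DirectSum.decomposeRingEquiv 𝒜).toRingHom

lemma smul_of {i j : ℕ} (a : 𝒜 i) (x : value F j) :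
    a.1 • (DirectSum.of (value F) j x : Total F) =
      DirectSum.of (value F) (i + j) (act F ⟨a.1, Or.inr ⟨i, rfl, a.2⟩⟩ x) := by
  change DirectSum.decompose 𝒜 a.1 • (DirectSum.of (value F) j x : Total F) = _
  rw [DirectSum.decompose_coe]
  exact DirectSum.Gmodule.of_smul_of (fun i => 𝒜 i) (value F) a x

lemma smul_of_homs {i j : ℕ} (a : GradedIndex.homs 𝒜 i j) (x : value F i) :
    a.1 • (DirectSum.of (value F) i x : Total F) = DirectSum.of (value F) j (act F a x) := by
  obtain ⟨a, ha⟩ := a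
  rcases ha with rfl | ⟨k, rfl, ha⟩
  · rw [show (⟨0, Or.inl rfl⟩ : GradedIndex.homs 𝒜 i j) = 0 from rfl, act_zero]
    simp
  · exact smul_of F ⟨a, ha⟩ x

/-- The homogeneous pieces of the direct sum. -/
abbrev totalPiece (i : ℕ) : AddSubgroup (Total F) := (DirectSum.of (value F) i).range

/-- The homogeneous pieces are the values of the diagram. -/
noncomputable def pieceEquiv (i : ℕ) : value F i ≃+ totalPiece F i :=
  AddMonoidHom.ofInjective (DirectSum.of_injective i)

/-- The isomorphism between a homogeneous piece and the value of the diagram. -/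
noncomputable def pieceIso (i : ℕ) : AddCommGrpCat.of (totalPiece F i) ≅ F.obj.obj ⟨i⟩ where
  hom := AddCommGrpCat.ofHom (pieceEquiv F i).symm.toAddMonoidHom
  inv := AddCommGrpCat.ofHom (pieceEquiv F i).toAddMonoidHom
  hom_inv_id := by
    ext x : 2
    exact (pieceEquiv F i).apply_symm_apply x
  inv_hom_id := by
    ext x
    exact (pieceEquiv F i).symm_apply_apply x

noncomputable instance : DirectSum.Decomposition (totalPiece F) :=
  Decomposition.ofAddHom (ℳ := totalPiece F)
    (DirectSum.toAddMonoid fun i : ℕ =>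
      (DirectSum.of (fun i => totalPiece F i) i).comp (pieceEquiv F i).toAddMonoidHom)
    (by
      ext i x : 2
      simp [pieceEquiv]
      rfl)
    (by
      ext i ⟨_, x, rfl⟩ : 2
      simp [pieceEquiv]
      rfl)

instance : SetLike.GradedSMul 𝒜 (totalPiece F) where
  smul_mem := by
    rintro i j a _ ha ⟨x, rfl⟩
    exact ⟨_, (smul_of F ⟨a, ha⟩ x).symm⟩

/-- The graded module of a diagram. -/
noncomputable def total : GrModCat 𝒜 where
  carrier := Total F
  piece := totalPiece F

/-- The diagram of the graded module of a diagram is the original one. -/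
noncomputable def totalIso : (toDiagram 𝒜).obj (total F) ≅ F :=
  ObjectProperty.isoMk _ (NatIso.ofComponents
    (fun i => pieceIso F i.deg) (by
      intro i j a
      ext x
      obtain ⟨y, rfl⟩ := (pieceEquiv F i.deg).surjective x
      change (pieceEquiv F j.deg).symm (smulHom (total F) a (pieceEquiv F i.deg y)) =
        act F a ((pieceEquiv F i.deg).symm (pieceEquiv F i.deg y))
      rw [AddEquiv.symm_apply_apply]
      exact (pieceEquiv F j.deg).symm_apply_eq.2 (Subtype.ext (smul_of_homs F a y))))

end EssSurj

instance : (toDiagram 𝒜).EssSurj := ⟨fun F => ⟨total F, ⟨totalIso F⟩⟩⟩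
instance : (toDiagram 𝒜).IsEquivalence where

instance : HasFiniteProducts (GrModCat 𝒜) :=
  ⟨fun _ => Adjunction.hasLimitsOfShape_of_equivalence (toDiagram 𝒜)⟩

instance : (toDiagram 𝒜).Additive where
  map_add := rfl

noncomputable instance : Abelian (GrModCat 𝒜) := abelianOfEquivalence (toDiagram 𝒜)

instance : IsGrothendieckAbelian.{u} (GrModCat 𝒜) :=
  IsGrothendieckAbelian.of_equivalence (toDiagram 𝒜).asEquivalence.symm

instance {O : Type u} [Category.{u} O] (J : GrothendieckTopology O) : HasSheafify J (GrModCat 𝒜) :=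
  AdditiveDiagrams.hasSheafify (toDiagram 𝒜) J

end GrModCat

/-! ### The comparison over an arbitrary Grothendieck abelian coefficient category -/

namespace SheafCohomology

/-! The point is that both maps are computed by a single cochain map. Let `g : f^* I ⟶ J` lift the
identity of `f^* F`. Its adjoint is the composite `I ⟶ f_* f^* I ⟶ f_* J` of the unit with `f_* g`.
Since `f_*` is exact, and preserves injectives as the right adjoint of the exact functor `f^*`, the
complex `f_* J` is an injective resolution of `f_* f^* F`.

Transposing the condition that `g` lifts the identity shows that the adjoint lies over `η_F : F ⟶
f_* f^* F` (`LiftsIdentity.ι_comp_adjointCochainMap`). Hence applying `Γ(Y, -)` to it and taking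
cohomology gives `H^k(Y, η_F)`. On the other hand, under `Γ(Y, f_* J) = Γ(X, J)`, its global
sections are those of the unit followed by `Γ(X, g)` (`map_adjointCochainMap_comp`), and this is the
cochain map that defines `H^k(f)`.

The isomorphism may be taken from a resolution `J'` other than `J`. A comparison map `h : J ⟶ J'`
over the identity of `f^* F` is compatible with the identifications of both cohomologies with the
derived functor, so `g` may be replaced by `g ≫ h` (`LiftsIdentity.comp_desc`).

The only property of the adjunction used in transposing is `comp_unit_app_comp_map`. Applied to the
differentials it makes the adjoint a cochain map; applied to the coaugmentations it gives the lift
of the unit. -/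

lemma comp_unit_app_comp_map {C D : Type*} [Category* C] [Category* D] {L : C ⥤ D} {R : D ⥤ C}
    (adj : L ⊣ R) {a b : C} {c : D} (d : a ⟶ b) (g : L.obj b ⟶ c) {e : L.obj a ⟶ c}
    (h : L.map d ≫ g = e) : d ≫ adj.unit.app b ≫ R.map g = adj.unit.app a ≫ R.map e := by
  subst h
  simp

variable {A : Type (u + 1)} [Category.{u} A] [Abelian A] [IsGrothendieckAbelian.{u} A]
  [∀ Z : TopCat.{u}, HasSheafify (Opens.grothendieckTopology Z) A]
  {X Y : TopCat.{u}} {f : X ⟶ Y} {F : Y.Sheaf A}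

/-- Serves to append the last identification with the derived functor to an equality of maps on
cohomology. Since it is applied as a term, the composites only have to match up to definitional
unfolding. -/
lemma comp₄_eq_comp₃ {C : Type*} [Category* C] {a b c d e b' : C} {u : a ⟶ b} {v : b ⟶ c}
    {w : c ⟶ d} {u' : a ⟶ b'} {v' : b' ⟶ d} (h : u ≫ v ≫ w = u' ≫ v') (t : d ⟶ e) :
    u ≫ v ≫ w ≫ t = u' ≫ v' ≫ t := by
  simpa only [Category.assoc] using h =≫ t

/-! ### Adjoint cochain maps, their global sections and their coaugmentations -/

/-- The adjoint `I ⟶ f_* f^* I ⟶ f_* K` of a cochain map `f^* I ⟶ K`. -/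
noncomputable def adjointCochainMap {I : CochainComplex (Y.Sheaf A) ℕ}
    {K : CochainComplex (X.Sheaf A) ℕ}
    (g : ((inverseImage A f).mapHomologicalComplex _).obj I ⟶ K) :
    I ⟶ ((TopCat.Sheaf.pushforward A f).mapHomologicalComplex _).obj K where
  f n := (adjunction A f).unit.app (I.X n) ≫ (TopCat.Sheaf.pushforward A f).map (g.f n)
  comm' i j _ := by
    -- Compatibility of `g` with the differentials is an equality of maps out of `f^*(I.X i)`; its
    -- transpose under the adjunction is the required square.
    refine (Category.assoc _ _ _).trans (Eq.trans ?_
      (comp_unit_app_comp_map (adjunction A f) (I.d i j) (g.f j) (g.comm i j).symm).symm)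
    exact congrArg ((adjunction A f).unit.app (I.X i) ≫ ·)
      ((TopCat.Sheaf.pushforward A f).map_comp (g.f i) (K.d i j)).symm

/-- `Γ(Y, -)` of the adjoint of `g` is `Γ(X, g)` after the unit. -/
lemma map_adjointCochainMap_comp {I : CochainComplex (Y.Sheaf A) ℕ}
    {K : CochainComplex (X.Sheaf A) ℕ}
    (g : ((inverseImage A f).mapHomologicalComplex _).obj I ⟶ K) :
    ((globalSections A Y).mapHomologicalComplex _).map (adjointCochainMap g) ≫
        ((NatIso.mapHomologicalComplex (pushforwardSections f) (ComplexShape.up ℕ)).app K).hom =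
      unitCochainMap I ≫ ((globalSections A X).mapHomologicalComplex _).map g := by
  ext n
  -- The identification `Γ(Y, f_* K) = Γ(X, K)` is an identity in every degree, so only
  -- functoriality of `Γ(Y, -)` remains, together with the definitional equality of `Γ(Y, f_* φ)`
  -- and `Γ(X, φ)`.
  change (globalSections A Y).map
    ((adjunction A f).unit.app (I.X n) ≫ (TopCat.Sheaf.pushforward A f).map (g.f n)) ≫ 𝟙 _ =
    ((globalSections A Y).map ((adjunction A f).unit.app (I.X n)) ≫ 𝟙 _) ≫
      (globalSections A X).map (g.f n)
  rw [Functor.map_comp, Category.comp_id, Category.comp_id]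
  rfl

/-- The adjoint of a cochain map lifting the identity of `f^* F` lifts the unit
`F ⟶ f_* f^* F`. -/
lemma LiftsIdentity.ι_comp_adjointCochainMap (hf : PushforwardExact A f)
    {I : InjectiveResolution F} {J : InjectiveResolution ((inverseImage A f).obj F)}
    {g : ((inverseImage A f).mapHomologicalComplex _).obj I.cocomplex ⟶ J.cocomplex}
    (hg : LiftsIdentity I J g) :
    I.ι.f 0 ≫ (adjointCochainMap g).f 0 =
      (adjunction A f).unit.app F ≫ (pushforwardResolution hf J).ι.f 0 := by
  -- The augmentation of `f_* J` also contains the comparison of `f_*` with complexes concentrated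
  -- in degree `0`. In that degree the comparison is a composite of identities.
  have hJ : (pushforwardResolution hf J).ι.f 0 =
      (TopCat.Sheaf.pushforward A f).map (coaugmentation J) := by
    change (_ ≫ ((TopCat.Sheaf.pushforward A f).mapHomologicalComplex _).map J.ι).f 0 = _
    rw [HomologicalComplex.comp_f,
      HomologicalComplex.singleMapHomologicalComplex_inv_app_self]
    exact (congrArg (· ≫ (TopCat.Sheaf.pushforward A f).map (coaugmentation J))
      ((congrArg (𝟙 _ ≫ ·) ((TopCat.Sheaf.pushforward A f).map_id _)).trans
        (Category.id_comp _))).trans (Category.id_comp _)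
  rw [hJ]
  exact comp_unit_app_comp_map (adjunction A f) (coaugmentation I) (g.f 0) hg

/-! ### Change of the resolution of `f^* F`, and the comparison -/

/-- Allows the resolution defining `H^k(f)` to differ from the one defining the isomorphism. -/
lemma LiftsIdentity.comp_desc {I : InjectiveResolution F}
    {J J' : InjectiveResolution ((inverseImage A f).obj F)}
    {g : ((inverseImage A f).mapHomologicalComplex _).obj I.cocomplex ⟶ J.cocomplex}
    (hg : LiftsIdentity I J g) {h : J.cocomplex ⟶ J'.cocomplex}
    (hh : J.ι.f 0 ≫ h.f 0 = J'.ι.f 0) : LiftsIdentity I J' (g ≫ h) := by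
  unfold LiftsIdentity at hg ⊢
  exact (Category.assoc _ (g.f 0) (h.f 0)).symm.trans ((congrArg (· ≫ h.f 0) hg).trans hh)

/-- If `f_*` is exact, `H^k(f)` is the map induced by the unit followed by the isomorphism
`H^k(Y, f_* f^* F) ≅ H^k(X, f^* F)`. -/
theorem inducedMap_eq (hf : PushforwardExact A f) (I : InjectiveResolution F)
    (J J' : InjectiveResolution ((inverseImage A f).obj F))
    (g : ((inverseImage A f).mapHomologicalComplex _).obj I.cocomplex ⟶ J.cocomplex)
    (hg : LiftsIdentity I J g) (k : ℕ) :
    inducedMap I J g k = (cohomology A Y k).map ((adjunction A f).unit.app F) ≫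
      (pushforwardCohomologyIso hf J' k).hom := by
  let h : J.cocomplex ⟶ J'.cocomplex := InjectiveResolution.desc (𝟙 _) J' J
  have hh : J.ι.f 0 ≫ h.f 0 = J'.ι.f 0 :=
    (InjectiveResolution.desc_commutes_zero (𝟙 _) J' J).trans (Category.id_comp _)
  -- The adjoint of `g ≫ h` lies over the unit, so it computes `H^k(Y, η_F)` through the resolutions
  -- `I` and `f_* J'`.
  have h₁ := InjectiveResolution.isoRightDerivedObj_hom_naturality _ I
    (pushforwardResolution hf J') (adjointCochainMap (g ≫ h))
    ((hg.comp_desc hh).ι_comp_adjointCochainMap hf) (globalSections A Y) k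
  -- As `h` lies over the identity, the identification through `J` is `H^k(Γ(X, h))` followed by the
  -- one through `J'`.
  have h₂ := InjectiveResolution.isoRightDerivedObj_inv_naturality (𝟙 _) J J' h
    (hh.trans (Category.id_comp _).symm) (globalSections A X) k
  have h₃ := congrArg (HomologicalComplex.homologyMap · k) (map_adjointCochainMap_comp (g ≫ h))
  -- On cohomology, the adjoint of `g ≫ h` splits into the unit, `g` and `h`.
  have h₄ := ((HomologicalComplex.homologyMap_comp _ _ k).symm.trans h₃).trans
    ((HomologicalComplex.homologyMap_comp _ _ k).trans
      (congrArg (HomologicalComplex.homologyMap (unitCochainMap I.cocomplex) k ≫ ·)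
        ((congrArg (HomologicalComplex.homologyMap · k)
          (((globalSections A X).mapHomologicalComplex _).map_comp g h)).trans
            (HomologicalComplex.homologyMap_comp _ _ k))))
  rw [CategoryTheory.Functor.map_id, Category.comp_id] at h₂
  unfold inducedMap pushforwardCohomologyIso cohomology
  rw [Iso.trans_hom, Iso.trans_hom, Iso.symm_hom, reassoc_of% h₁, h₂]
  exact congrArg ((I.isoRightDerivedObj (globalSections A Y) k).hom ≫ ·)
    (comp₄_eq_comp₃ h₄.symm (J'.isoRightDerivedObj (globalSections A X) k).inv)

end SheafCohomology

/-! ### Coefficients in modules and in graded modules -/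

theorem proposition452 {R : Type u} [CommRing R] {X Y : TopCat.{u}} (f : X ⟶ Y) (k : ℕ) :
    (∀ (hf : SheafCohomology.PushforwardExact (ModuleCat.{u} R) f)
        (F : Y.Sheaf (ModuleCat.{u} R))
        (I : InjectiveResolution F)
        (J J' : InjectiveResolution
          ((SheafCohomology.inverseImage (ModuleCat.{u} R) f).obj F))
        (g : ((SheafCohomology.inverseImage (ModuleCat.{u} R) f).mapHomologicalComplex _).obj
          I.cocomplex ⟶ J.cocomplex)
        (_ : SheafCohomology.LiftsIdentity I J g),
      SheafCohomology.inducedMap I J g k =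
        (SheafCohomology.cohomology (ModuleCat.{u} R) Y k).map
            ((SheafCohomology.adjunction (ModuleCat.{u} R) f).unit.app F) ≫
          (SheafCohomology.pushforwardCohomologyIso hf J' k).hom) ∧
    (∀ (𝒜 : ℕ → AddSubgroup R) [GradedRing 𝒜]
        (hf : SheafCohomology.PushforwardExact (GrModCat 𝒜) f)
        (F : Y.Sheaf (GrModCat 𝒜))
        (I : InjectiveResolution F)
        (J J' : InjectiveResolution
          ((SheafCohomology.inverseImage (GrModCat 𝒜) f).obj F))
        (g : ((SheafCohomology.inverseImage (GrModCat 𝒜) f).mapHomologicalComplex _).obj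
          I.cocomplex ⟶ J.cocomplex)
        (_ : SheafCohomology.LiftsIdentity I J g),
      SheafCohomology.inducedMap I J g k =
        (SheafCohomology.cohomology (GrModCat 𝒜) Y k).map
            ((SheafCohomology.adjunction (GrModCat 𝒜) f).unit.app F) ≫
          (SheafCohomology.pushforwardCohomologyIso hf J' k).hom) :=
  ⟨fun hf _ I J J' g hg => SheafCohomology.inducedMap_eq hf I J J' g hg k,
    fun _ _ hf _ I J J' g hg => SheafCohomology.inducedMap_eq hf I J J' g hg k⟩
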